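/- **Setting.** There are $n\ge 2$ agents and $m$ divisible items, with click-through rates $\phi_{ij}\ge 0$. An allocation is $x=(x_{ij})$ with $x_{ij}\ge 0$; it is feasible if $\sum_i x_{ij}\le 1$ for every $j$. Agent $i$ has a type $(V_i,w_i,C_i)$: a differentiable, weakly increasing, concave valuation $V_i:\mathbb R_+\to\mathbb R_+$ with $V_i(0)=0$, a hard budget $w_i\in[0,\infty]$, and a differentiable, weakly increasing, convex money cost $C_i:\mathbb R_+\to\mathbb R_+$ with $C_i(0)=0$, where $w_i<\infty$ or $C_i\not\equiv 0$. Her utility for allocation $x_i$ and payment $t_i$ is $V_i(\sum_j\phi_{ij}x_{ij})-C_i(t_i)$ if $t_i\le w_i$ and $t_i<\infty$, and $-\infty$ otherwise. **Metagame.** Each agent $i$ reports a message $(\tilde v_i,\tilde w_i)\in[0,\infty]^2$. The outcome is a first-price pacing equilibrium (FPPE) of the reports, that is, per-unit prices $p_j\in[0,\infty]$, a feasible allocation $x$ and payments $t_i=\sum_j p_jx_{ij}$ (with $0\cdot\infty=0$) such that: (1) if $x_{ij}>0$ then $\phi_{ij'}p_j\le\phi_{ij}p_{j'}$ for all $j'$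 (highest bang-per-buck) and $p_j\le\tilde v_i\phi_{ij}$; (2) $\sum_i x_{ij}=1$ whenever $p_j>0$; (3) $t_i\le\tilde w_i$, with equality if $\tilde v_i\phi_{ij}>p_j$ for some $j$. When the FPPE is not unique, it is selected by a fixed tie-breaking rule $\sigma$, a measurable function of the message profile. A mixed Nash equilibrium is a profile of independent random messages such that no agent can increase her expected utility by deviating to any message. **Liquid welfare.** For a (possibly randomized) allocation $\mathbf x$, $$W(\mathbf x)=\sum_{i=1}^n\min\Big\{w_i,\;C_i^{-1}\Big(\mathbb E\Big[V_i\Big(\sum_j\phi_{ij}\mathbf x_{ij}\Big)\Big]\Big)\Big\},\qquad C_i^{-1}(y)=\sup\{t\ge 0: C_i(t)\le y\}.$$ The mixed price of anarchy is $$\mathrm{PoA}_{\mathrm{Mixed}}=\sup_{n,m,\phi,(V_i,w_i,C_i)_i}\ \frac{\sup_{x}W(x)}{\inf_{\mathbf x}W(\mathbf x)},$$ where $x$ ranges over the feasible allocations and $\mathbf x$ over the randomized allocations induced by the mixed Nash equilibria of the instance (with the conventions $0/0=0$, $a/0=\infty$ for $a>0$, and ratio $0$ if there is no equilibrium). **Theorem.**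 For every instance and every tie-breaking rule, the randomized allocation $\mathbf x$ induced by any mixed Nash equilibrium of the metagame satisfies $W(\mathbf y)\le 4\,W(\mathbf x)$ for every feasible, possibly randomized, allocation $\mathbf y$; that is, its liquid welfare is at least $1/4$ of the optimal liquid welfare. Moreover, for every choice of a tie-breaking rule for each $(n,m,\phi)$, $2\le\mathrm{PoA}_{\mathrm{Mixed}}\le 4$. -/

import Mathlib

open MeasureTheory
open scoped ENNReal NNReal

noncomputable section

namespace Metagame

/-- The type `(V, w, C)` of a general agent. Only the restrictions of `value` and `cost` to
`[0, ∞)` matter; `value` and `cost` are nonnegative there by monotonicity. -/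
structure AgentType where
  /-- valuation `V` of the number of received clicks -/
  value : ℝ → ℝ
  /-- hard budget `w`, possibly infinite -/
  budget : ℝ≥0∞
  /-- money cost `C` of a payment -/
  cost : ℝ → ℝ
  value_zero : value 0 = 0
  value_mono : MonotoneOn value (Set.Ici 0)
  value_concave : ConcaveOn ℝ (Set.Ici 0) value
  value_diff : DifferentiableOn ℝ value (Set.Ici 0)
  cost_zero : cost 0 = 0
  cost_mono : MonotoneOn cost (Set.Ici 0)
  cost_convex : ConvexOn ℝ (Set.Ici 0) cost
  cost_diff : DifferentiableOn ℝ cost (Set.Ici 0)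
  budget_or_cost : budget ≠ ⊤ ∨ ∃ t : ℝ, 0 ≤ t ∧ 0 < cost t

open scoped Classical in
/-- Utility `V(clicks) - C(payment)` if the payment is within the hard budget, `-∞` otherwise.
An infinite payment always has utility `-∞` (with an infinite budget, `C` is unbounded). -/
def AgentType.utility (T : AgentType) (clicks : ℝ≥0) (pay : ℝ≥0∞) : EReal :=
  if pay ≤ T.budget ∧ pay ≠ ⊤ then ((T.value clicks - T.cost pay.toReal : ℝ) : EReal) else ⊥

/-- The inverse of the money cost function: the largest payment whose cost is at most `y`. -/
def AgentType.costInv (T : AgentType) (y : ℝ) : ℝ≥0∞ :=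
  ⨆ (t : ℝ≥0) (_ : T.cost t ≤ y), (t : ℝ≥0∞)

/-- `x i j` is the fraction of item `j` that agent `i` receives. -/
abbrev Allocation (n m : ℕ) := Fin n → Fin m → ℝ≥0

/-- No item is oversold (in particular all fractions lie in `[0, 1]`). -/
def Allocation.IsFeasible {n m : ℕ} (x : Allocation n m) : Prop :=
  ∀ j, ∑ i, x i j ≤ 1

/-- Number of clicks of agent `i`, for click-through rates `φ`. -/
def clicks {n m : ℕ} (φ : Fin n → Fin m → ℝ≥0) (x : Allocation n m) (i : Fin n) : ℝ≥0 :=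
  ∑ j, φ i j * x i j

/-- A message `(v, w)`: a maximum bid (value per click) and a budget, either possibly infinite. -/
abbrev Message := ℝ≥0∞ × ℝ≥0∞

/-- The payment of agent `i` at per-unit prices `p`. -/
def payment {n m : ℕ} (p : Fin m → ℝ≥0∞) (x : Allocation n m) (i : Fin n) : ℝ≥0∞ :=
  ∑ j, (x i j : ℝ≥0∞) * p j

/-- First-price pacing equilibrium `(p, x)` for budgeted agents with types `b i = (v i, w i)`.
Ratios `φ / p` are compared after clearing denominators, so that zero prices and infinite values
or prices are covered (`0 * ∞ = 0`). -/
structure IsFPPE {n m : ℕ} (φ : Fin n → Fin m → ℝ≥0) (b : Fin n → Message)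
    (p : Fin m → ℝ≥0∞) (x : Allocation n m) : Prop where
  /-- an agent only receives items of the highest bang-per-buck `φ i j / p j` -/
  bang_per_buck : ∀ i j, 0 < x i j → ∀ j', (φ i j' : ℝ≥0∞) * p j ≤ (φ i j : ℝ≥0∞) * p j'
  /-- an agent only receives items priced at most at her value -/
  price_le_value : ∀ i j, 0 < x i j → p j ≤ (b i).1 * (φ i j : ℝ≥0∞)
  supply : x.IsFeasible
  sold_out : ∀ j, 0 < p j → ∑ i, x i j = 1
  budget_feasible : ∀ i, payment p x i ≤ (b i).2
  /-- the budget is exhausted if some item has bang-per-buck `v i * φ i j / p j > 1` -/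
  budget_exhausted : ∀ i, (∃ j, p j < (b i).1 * (φ i j : ℝ≥0∞)) → payment p x i = (b i).2

/-- A tie-breaking rule for click-through rates `φ`: a (measurable) choice of an FPPE for every
message profile. -/
structure TieBreakingRule {n m : ℕ} (φ : Fin n → Fin m → ℝ≥0) where
  price : (Fin n → Message) → Fin m → ℝ≥0∞
  alloc : (Fin n → Message) → Allocation n m
  isFPPE : ∀ b, IsFPPE φ b (price b) (alloc b)
  measurable_price : Measurable price
  measurable_alloc : Measurable alloc

/-- An instance: at least two agents, divisible items, click-through rates, agents' types. -/
structure Market where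
  n : ℕ
  m : ℕ
  two_le_n : 2 ≤ n
  ctr : Fin n → Fin m → ℝ≥0
  agent : Fin n → AgentType

/-- Utility of agent `i` in the metagame at message profile `b`. -/
def Market.utility (I : Market) (σ : TieBreakingRule I.ctr) (i : Fin I.n)
    (b : Fin I.n → Message) : EReal :=
  (I.agent i).utility (clicks I.ctr (σ.alloc b) i) (payment (σ.price b) (σ.alloc b) i)

/-- Expectation of an extended-real random variable: the difference of the expectations of its
positive and negative parts (the utilities it is used for are bounded above). -/
def expectation {Ω : Type*} [MeasurableSpace Ω] (μ : Measure Ω) (f : Ω → EReal) : EReal :=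
  ((∫⁻ ω, (f ω).toENNReal ∂μ : ℝ≥0∞) : EReal) - ((∫⁻ ω, (-f ω).toENNReal ∂μ : ℝ≥0∞) : EReal)

/-- The law of the message profile when agents randomize independently. -/
def profileLaw {n : ℕ} (s : Fin n → ProbabilityMeasure Message) : Measure (Fin n → Message) :=
  Measure.pi fun i => (s i : Measure Message)

/-- Mixed Nash equilibrium of the metagame: no agent gains by deviating to any message `d`. -/
def Market.IsMixedNash (I : Market) (σ : TieBreakingRule I.ctr)
    (s : Fin I.n → ProbabilityMeasure Message) : Prop :=
  ∀ (i : Fin I.n) (d : Message),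
    expectation (profileLaw s) (fun b => I.utility σ i (Function.update b i d)) ≤
      expectation (profileLaw s) (fun b => I.utility σ i b)

/-- The willingness to pay `min {w, C⁻¹ (E[V(clicks)])}` of agent `i` for a randomized allocation
with law `ν`. -/
def Market.willingnessToPay (I : Market) (ν : Measure (Allocation I.n I.m)) (i : Fin I.n) :
    ℝ≥0∞ :=
  min (I.agent i).budget
    ((I.agent i).costInv (∫ x, (I.agent i).value (clicks I.ctr x i) ∂ν))

/-- The liquid welfare of a randomized allocation with law `ν`. -/
def Market.liquidWelfare (I : Market) (ν : Measure (Allocation I.n I.m)) : ℝ≥0∞ :=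
  ∑ i, I.willingnessToPay ν i

/-- The law of the randomized allocation induced by the mixed message profile `s`. -/
def Market.inducedAllocation (I : Market) (σ : TieBreakingRule I.ctr)
    (s : Fin I.n → ProbabilityMeasure Message) : Measure (Allocation I.n I.m) :=
  (profileLaw s).map σ.alloc

/-- The optimal liquid welfare over all feasible (deterministic) allocations. -/
def Market.optimalWelfare (I : Market) : ℝ≥0∞ :=
  ⨆ (x : Allocation I.n I.m) (_ : x.IsFeasible), I.liquidWelfare (Measure.dirac x)

/-- The price of anarchy under mixed Nash equilibrium, when ties are broken by `σ`: the supremum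
over all instances of the optimal liquid welfare divided by the infimum of the liquid welfare
over all mixed Nash equilibria. Here `0 / 0 = 0`, `a / 0 = ∞` for `a > 0`, and an instance without
equilibrium contributes `a / ∞ = 0`. -/
def mixedPoA (σ : ∀ (n m : ℕ) (φ : Fin n → Fin m → ℝ≥0), TieBreakingRule φ) : ℝ≥0∞ :=
  ⨆ I : Market, I.optimalWelfare /
    ⨅ (s : Fin I.n → ProbabilityMeasure Message) (_ : I.IsMixedNash (σ I.n I.m I.ctr) s),
      I.liquidWelfare (I.inducedAllocation (σ I.n I.m I.ctr) s)

end Metagame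

end

/-!
Why the liquid welfare of an equilibrium is at least a quarter of the optimum. If agent `i`
unilaterally changes her message, the prices rise by at most her new payment in total
(`IsFPPE.sum_price_rise_le`): anyone else who buys an item whose price has risen had strictly better
offers before, so she was already spending her whole budget on such items. Hence the message
"unlimited value, budget `B`" buys at least the fraction `B / (p·y + B)` of the clicks of any bundle
`y` of at most one unit per item, where `p` are the prices before the deviation
(`IsFPPE.clicks_mul_le_of_deviation`). By concavity of the value and convexity of `q ↦ B / (q + B)`,
in a mixed equilibrium this deviation has expected utility at least
`V(y) * B / (P + B) - C(B)`, where `P` is the expected price of `y`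
(`Market.IsMixedNash.value_mul_le`).

Let `W` be the equilibrium willingness to pay of the agent and `W'` the one for `y`. If `W < W'`, take
`B` slightly above `W`: then `C(B)` exceeds the equilibrium value, while `V(y)` is at least about
`C(W') ≥ (W' / B) C(B)`. As the deviation does not pay, `W' ≤ 2 (P + W)`
(`Market.IsMixedNash.willingnessToPay_le`). Summing over the agents, for a feasible `y` the prices `P`
add up to at most the expected revenue, which is at most the equilibrium welfare, because each
expected payment is at most the willingness to pay (`Market.IsMixedNash.lintegral_payment_le`). This
gives the factor `2 (1 + 1) = 4`. A randomized `y` is replaced by its mean, as values are concave.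

For the lower bound (`two_le_mixedPoA`), two agents compete for one item: one with value `1` per click
and no budget constraint, the other with value `1/ε` per click and hard budget `1`. In a pure
equilibrium the latter spends her budget and wins the whole item at price `1`, with welfare `1`, since
the truthful bid of the former keeps the price at `1`. Giving her only the fraction `ε` of the item
yields welfare `2 - ε`. The outcome of this message profile is the same under every tie-breaking rule.
-/

namespace Metagame

/-! ### First-price pacing equilibria under a unilateral deviation -/

section Pacing

variable {n m : ℕ} {φ : Fin n → Fin m → ℝ≥0} {b b' : Fin n → Message} {p p' : Fin m → ℝ≥0∞}
  {x x' : Allocation n m} {i : Fin n}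

theorem IsFPPE.sum_mul_price (h : IsFPPE φ b p x) (j : Fin m) :
    ∑ k, (x k j : ℝ≥0∞) * p j = p j := by
  rcases eq_or_ne (p j) 0 with h0 | h0
  · simp [h0]
  · rw [← Finset.sum_mul, ← ENNReal.ofNNReal_finsetSum, h.sold_out j (pos_iff_ne_zero.2 h0)]
    simp

theorem IsFPPE.sum_payment (h : IsFPPE φ b p x) : ∑ k, payment p x k = ∑ j, p j := by
  unfold payment
  rw [Finset.sum_comm]
  exact Finset.sum_congr rfl fun j _ => h.sum_mul_price j

theorem Allocation.IsFeasible.le_one (h : x.IsFeasible) (i : Fin n) (j : Fin m) : x i j ≤ 1 :=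
  (Finset.single_le_sum (f := fun k => x k j) (fun _ _ => zero_le) (Finset.mem_univ i)).trans
    (h j)

theorem clicks_le_of_le_one {y : Allocation n m} (hy : ∀ j, y i j ≤ 1) :
    clicks φ y i ≤ ∑ j, φ i j :=
  Finset.sum_le_sum fun j _ => mul_le_of_le_one_right zero_le (hy j)

/-- If an agent with the same message in both equilibria buys an item whose price rises, then at
the lower prices she exhausts her budget, and only on items whose prices rise: these give strictly
more per unit of money than all others. So she spends no more on them after the rise. -/
theorem IsFPPE.sum_payment_rise_le (h : IsFPPE φ b p x) (h' : IsFPPE φ b' p' x') {k : Fin n}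
    (hk : b' k = b k) :
    ∑ j with p j < p' j, (x' k j : ℝ≥0∞) * p' j ≤ ∑ j with p j < p' j, (x k j : ℝ≥0∞) * p j := by
  by_cases hex : ∃ j, p j < p' j ∧ 0 < x' k j
  · obtain ⟨j, hj, hxj⟩ := hex
    have hval : p' j ≤ (b k).1 * φ k j := hk ▸ h'.price_le_value k j hxj
    have hpay : payment p x k = (b k).2 := h.budget_exhausted k ⟨j, hj.trans_le hval⟩
    have hφj : (φ k j : ℝ≥0∞) ≠ 0 := by
      rintro h0
      rw [h0, mul_zero] at hval
      exact absurd (hj.trans_le hval) not_lt_zero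
    have hout : ∀ l, ¬ p l < p' l → (x k l : ℝ≥0∞) * p l = 0 := by
      intro l hl
      by_contra hne
      have hxl : 0 < x k l := by
        rw [pos_iff_ne_zero]; rintro h0; simp [h0] at hne
      have hpl : p l ≠ 0 := by rintro h0; simp [h0] at hne
      have h1 := h.bang_per_buck k l hxl j
      have h2 := h'.bang_per_buck k j hxj l
      have hφl : (φ k l : ℝ≥0∞) ≠ 0 := by
        rintro h0
        rw [h0, zero_mul, nonpos_iff_eq_zero, mul_eq_zero] at h1
        exact h1.elim hφj hpl
      have h3 : (φ k l : ℝ≥0∞) * p' j ≤ φ k l * p j :=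
        h2.trans ((mul_le_mul_right (not_lt.1 hl) _).trans h1)
      exact absurd hj (not_lt.2 ((ENNReal.mul_le_mul_iff_right hφl ENNReal.coe_ne_top).1 h3))
    calc ∑ j with p j < p' j, (x' k j : ℝ≥0∞) * p' j
        ≤ payment p' x' k := Finset.sum_le_sum_of_subset (Finset.filter_subset _ _)
      _ ≤ (b k).2 := hk ▸ h'.budget_feasible k
      _ = payment p x k := hpay.symm
      _ = ∑ j with p j < p' j, (x k j : ℝ≥0∞) * p j := by
          unfold payment
          rw [Finset.sum_filter]
          refine Finset.sum_congr rfl fun l _ => ?_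
          split_ifs with hl
          · rfl
          · exact hout l hl
  · push Not at hex
    rw [Finset.sum_eq_zero]
    · exact zero_le
    · intro j hj
      rw [nonpos_iff_eq_zero.1 (hex j (Finset.mem_filter.1 hj).2)]
      simp

/-- A unilateral deviation raises prices by at most the payment of the deviating agent. -/
theorem IsFPPE.sum_price_rise_le (h : IsFPPE φ b p x) (h' : IsFPPE φ b' p' x')
    (hb : ∀ k, k ≠ i → b' k = b k) :
    ∑ j with p j < p' j, p' j ≤ (∑ j with p j < p' j, p j) + payment p' x' i := by
  classical
  calc ∑ j with p j < p' j, p' j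
      = ∑ k, ∑ j with p j < p' j, (x' k j : ℝ≥0∞) * p' j := by
        rw [Finset.sum_comm]
        exact Finset.sum_congr rfl fun j _ => (h'.sum_mul_price j).symm
    _ = (∑ k ∈ Finset.univ.erase i, ∑ j with p j < p' j, (x' k j : ℝ≥0∞) * p' j) +
          ∑ j with p j < p' j, (x' i j : ℝ≥0∞) * p' j :=
        (Finset.sum_erase_add _ _ (Finset.mem_univ i)).symm
    _ ≤ (∑ k ∈ Finset.univ.erase i, ∑ j with p j < p' j, (x k j : ℝ≥0∞) * p j) +
          payment p' x' i := by
        refine add_le_add (Finset.sum_le_sum fun k hk => ?_)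
          (Finset.sum_le_sum_of_subset (Finset.filter_subset _ _))
        exact h.sum_payment_rise_le h' (hb k (Finset.ne_of_mem_erase hk))
    _ ≤ (∑ k, ∑ j with p j < p' j, (x k j : ℝ≥0∞) * p j) + payment p' x' i := by
        gcongr
        exact Finset.erase_subset _ _
    _ = _ := by
        rw [Finset.sum_comm]
        congr 1
        exact Finset.sum_congr rfl fun j _ => h.sum_mul_price j

theorem IsFPPE.price_ne_top_of_deviation (h : IsFPPE φ b p x) (h' : IsFPPE φ b' p' x')
    (hb : ∀ k, k ≠ i → b' k = b k) (hp : ∀ j, p j ≠ ⊤) (hpay : payment p' x' i ≠ ⊤)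
    (j : Fin m) : p' j ≠ ⊤ := by
  by_cases hj : p j < p' j
  · have hle := h.sum_price_rise_le h' hb
    have hfin : (∑ j with p j < p' j, p j) + payment p' x' i ≠ ⊤ :=
      ENNReal.add_ne_top.2 ⟨ENNReal.sum_ne_top.2 fun j _ => hp j, hpay⟩
    exact ENNReal.sum_ne_top.1 (ne_top_of_le_ne_top hfin hle) j (by simp [hj])
  · exact ne_top_of_le_ne_top (hp j) (not_lt.1 hj)

/-- The price of a bundle of at most one unit of each item rises by at most the payment of the
deviating agent. -/
theorem IsFPPE.payment_le_add_of_deviation (h : IsFPPE φ b p x) (h' : IsFPPE φ b' p' x')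
    (hb : ∀ k, k ≠ i → b' k = b k) (hp : ∀ j, p j ≠ ⊤) {y : Allocation n m}
    (hy : ∀ j, y i j ≤ 1) :
    payment p' y i ≤ payment p y i + payment p' x' i := by
  have hsub : ∑ j with p j < p' j, (p' j - p j) ≤ payment p' x' i := by
    have hle := h.sum_price_rise_le h' hb
    have hsplit : ∑ j with p j < p' j, p' j
        = (∑ j with p j < p' j, p j) + ∑ j with p j < p' j, (p' j - p j) := by
      rw [← Finset.sum_add_distrib]
      refine Finset.sum_congr rfl fun j hj => ?_
      rw [add_tsub_cancel_of_le (Finset.mem_filter.1 hj).2.le]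
    rw [hsplit] at hle
    exact (ENNReal.add_le_add_iff_left (ENNReal.sum_ne_top.2 fun j _ => hp j)).1 hle
  calc payment p' y i
      ≤ ∑ j, ((y i j : ℝ≥0∞) * p j + if p j < p' j then p' j - p j else 0) := by
        refine Finset.sum_le_sum fun j _ => ?_
        have hy1 : (y i j : ℝ≥0∞) ≤ 1 := by exact_mod_cast hy j
        split_ifs with hj
        · calc (y i j : ℝ≥0∞) * p' j = y i j * (p j + (p' j - p j)) := by
                rw [add_tsub_cancel_of_le hj.le]
            _ = y i j * p j + y i j * (p' j - p j) := mul_add _ _ _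
            _ ≤ _ := by gcongr; exact mul_le_of_le_one_left zero_le hy1
        · rw [add_zero]
          gcongr
          exact not_lt.1 hj
    _ = payment p y i + ∑ j with p j < p' j, (p' j - p j) := by
        rw [Finset.sum_add_distrib, Finset.sum_filter]; rfl
    _ ≤ _ := by gcongr

/-- An agent who reports an unlimited value and the budget `B` buys clicks at the best rate
available, hence at least at the rate at which the bundle `y i` supplies them at prices that have
risen by `B` in total. -/
theorem IsFPPE.clicks_mul_le_of_deviation (h : IsFPPE φ b p x) (h' : IsFPPE φ b' p' x')
    (hb : ∀ k, k ≠ i → b' k = b k) (hp : ∀ j, p j ≠ ⊤) {B : ℝ≥0} (hB : b' i = (⊤, (B : ℝ≥0∞)))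
    {y : Allocation n m} (hy : ∀ j, y i j ≤ 1) :
    (clicks φ y i : ℝ≥0∞) * B ≤ clicks φ x' i * (payment p y i + B) := by
  have hle : payment p' x' i ≤ B := by simpa [hB] using h'.budget_feasible i
  have hp' := h.price_ne_top_of_deviation h' hb hp (ne_top_of_le_ne_top ENNReal.coe_ne_top hle)
  by_cases hφ : ∃ j, φ i j ≠ 0
  · obtain ⟨j, hj⟩ := hφ
    have hpay : payment p' x' i = B := by
      have := h'.budget_exhausted i ⟨j, by
        rw [hB, ENNReal.top_mul (by exact_mod_cast hj)]
        exact (hp' j).lt_top⟩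
      rwa [hB] at this
    calc (clicks φ y i : ℝ≥0∞) * B
        = ∑ l, ∑ j, (y i l : ℝ≥0∞) * x' i j * (φ i l * p' j) := by
          rw [← hpay]
          unfold clicks payment
          push_cast
          rw [Finset.sum_mul_sum]
          exact Finset.sum_congr rfl fun l _ => Finset.sum_congr rfl fun j _ => by ring
      _ ≤ ∑ l, ∑ j, (y i l : ℝ≥0∞) * x' i j * (φ i j * p' l) := by
          refine Finset.sum_le_sum fun l _ => Finset.sum_le_sum fun j _ => ?_
          rcases eq_or_ne (x' i j) 0 with h0 | h0
          · simp [h0]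
          · exact mul_le_mul_right (h'.bang_per_buck i j (pos_iff_ne_zero.2 h0) l) _
      _ = clicks φ x' i * payment p' y i := by
          unfold clicks payment
          push_cast
          rw [Finset.sum_mul_sum, Finset.sum_comm]
          exact Finset.sum_congr rfl fun l _ => Finset.sum_congr rfl fun j _ => by ring
      _ ≤ clicks φ x' i * (payment p y i + B) := by
          gcongr
          exact hpay ▸ h.payment_le_add_of_deviation h' hb hp hy
  · push Not at hφ
    have h0 : clicks φ y i = 0 := by simp [clicks, hφ]
    simp [h0]

end Pacing

/-! ### Valuations and money costs -/

namespace AgentType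

variable (T : AgentType)

theorem value_nonneg {z : ℝ} (hz : 0 ≤ z) : 0 ≤ T.value z := by
  simpa [T.value_zero] using T.value_mono (Set.mem_Ici.2 le_rfl) hz hz

theorem cost_nonneg {t : ℝ} (ht : 0 ≤ t) : 0 ≤ T.cost t := by
  simpa [T.cost_zero] using T.cost_mono (Set.mem_Ici.2 le_rfl) ht ht

theorem mul_value_le {a z : ℝ} (ha : 0 ≤ a) (ha1 : a ≤ 1) (hz : 0 ≤ z) :
    a * T.value z ≤ T.value (a * z) := by
  have := T.value_concave.2 (Set.mem_Ici.2 hz) (Set.mem_Ici.2 le_rfl) ha (sub_nonneg.2 ha1)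
    (by ring)
  simpa [T.value_zero] using this

theorem mul_cost_le {B t : ℝ} (hB : 0 ≤ B) (hBt : B ≤ t) : t * T.cost B ≤ B * T.cost t := by
  rcases hB.eq_or_lt with rfl | hB0
  · simp [T.cost_zero]
  have ht : 0 < t := hB0.trans_le hBt
  have := T.cost_convex.2 (Set.mem_Ici.2 ht.le) (Set.mem_Ici.2 le_rfl)
    (div_nonneg hB ht.le) (sub_nonneg.2 ((div_le_one ht).2 hBt)) (by ring)
  simp only [smul_eq_mul, T.cost_zero, mul_zero, add_zero, div_mul_cancel₀ _ ht.ne'] at this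
  calc t * T.cost B ≤ t * (B / t * T.cost t) := by gcongr
    _ = B * T.cost t := by field_simp

theorem continuous_value : Continuous fun z : ℝ≥0 => T.value z :=
  T.value_diff.continuousOn.comp_continuous NNReal.continuous_coe fun z => z.2

theorem continuous_cost : Continuous fun t : ℝ≥0 => T.cost t :=
  T.cost_diff.continuousOn.comp_continuous NNReal.continuous_coe fun t => t.2

theorem costInv_mono : Monotone T.costInv := fun _ _ h =>
  iSup_mono fun _ => iSup_mono' fun ht => ⟨ht.trans h, le_rfl⟩

theorem le_costInv {t : ℝ≥0} {y : ℝ} (h : T.cost t ≤ y) : (t : ℝ≥0∞) ≤ T.costInv y :=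
  le_iSup₂ (f := fun (t : ℝ≥0) (_ : T.cost t ≤ y) => (t : ℝ≥0∞)) t h

theorem lt_cost_of_costInv_lt {t : ℝ≥0} {y : ℝ} (h : T.costInv y < t) : y < T.cost t :=
  not_le.1 fun hle => absurd h (not_lt.2 (T.le_costInv hle))

theorem cost_le_of_lt_costInv {t : ℝ≥0} {y : ℝ} (h : (t : ℝ≥0∞) < T.costInv y) :
    T.cost t ≤ y := by
  obtain ⟨u, hu⟩ := lt_iSup_iff.1 h
  obtain ⟨hy, hu⟩ := lt_iSup_iff.1 hu
  refine (T.cost_mono t.2 u.2 ?_).trans hy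
  exact_mod_cast hu.le

/-- The supporting line of the cost at a point of positive cost has positive slope. -/
theorem exists_tangent {B : ℝ≥0} (hB : 0 < T.cost B) :
    ∃ c : ℝ, 0 < c ∧ ∀ t : ℝ≥0, T.cost B + c * (t - B) ≤ T.cost t := by
  have hB0 : (0 : ℝ) < B := by
    refine B.coe_nonneg.lt_of_ne' fun h => ?_
    rw [h, T.cost_zero] at hB
    exact lt_irrefl _ hB
  have hd : HasDerivAt T.cost (deriv T.cost B) B :=
    (T.cost_diff.differentiableAt (Ici_mem_nhds hB0)).hasDerivAt
  have key : ∀ t : ℝ≥0, T.cost B + deriv T.cost B * (t - B) ≤ T.cost t := by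
    intro t
    rcases lt_trichotomy (t : ℝ) B with h | h | h
    · have := T.cost_convex.slope_le_of_hasDerivAt t.coe_nonneg B.coe_nonneg h hd
      rw [slope_def_field, div_le_iff₀ (sub_pos.2 h)] at this
      linarith
    · simp [h]
    · have := T.cost_convex.le_slope_of_hasDerivAt B.coe_nonneg t.coe_nonneg h hd
      rw [slope_def_field, le_div_iff₀ (sub_pos.2 h)] at this
      linarith
  refine ⟨_, ?_, key⟩
  have h0 := key 0
  simp only [NNReal.coe_zero, T.cost_zero] at h0
  by_contra hc
  nlinarith [not_lt.1 hc]

end AgentType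

/-! ### Expectations of extended-real utilities -/

section Expectation

variable {Ω : Type*} [MeasurableSpace Ω] {μ : Measure Ω}

theorem integral_eq_lintegral_toENNReal_sub {g : Ω → ℝ} (hg : Integrable g μ) :
    ((∫ ω, g ω ∂μ : ℝ) : EReal) =
      ((∫⁻ ω, (g ω : EReal).toENNReal ∂μ : ℝ≥0∞) : EReal) -
        ((∫⁻ ω, (-(g ω : EReal)).toENNReal ∂μ : ℝ≥0∞) : EReal) := by
  have hneg : ∫⁻ ω, ENNReal.ofReal (-g ω) ∂μ ≠ ⊤ := hg.neg.lintegral_lt_top.ne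
  rw [integral_eq_lintegral_pos_part_sub_lintegral_neg_part hg, EReal.coe_sub,
    EReal.coe_ennreal_toReal hg.lintegral_lt_top.ne, EReal.coe_ennreal_toReal hneg]
  rfl

theorem expectation_congr {f g : Ω → EReal} (h : f =ᵐ[μ] g) :
    expectation μ f = expectation μ g := by
  unfold expectation
  congr 2
  · exact lintegral_congr_ae (h.mono fun ω hω => by simp only [hω])
  · exact lintegral_congr_ae (h.mono fun ω hω => by simp only [hω])

theorem expectation_mono {f g : Ω → EReal} (h : f ≤ᵐ[μ] g) :
    expectation μ f ≤ expectation μ g := by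
  refine EReal.sub_le_sub ?_ ?_ <;> rw [EReal.coe_ennreal_le_coe_ennreal_iff]
  · exact lintegral_mono_ae (h.mono fun ω hω => EReal.toENNReal_le_toENNReal hω)
  · exact lintegral_mono_ae (h.mono fun ω hω =>
      EReal.toENNReal_le_toENNReal (EReal.neg_le_neg_iff.2 hω))

theorem integral_le_expectation {f : Ω → EReal} {g : Ω → ℝ} (hg : Integrable g μ)
    (h : ∀ᵐ ω ∂μ, (g ω : EReal) ≤ f ω) : ((∫ ω, g ω ∂μ : ℝ) : EReal) ≤ expectation μ f := by
  rw [integral_eq_lintegral_toENNReal_sub hg]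
  exact expectation_mono h

/-- If a random utility that is bounded above has a nonnegative expectation, then it is almost
surely finite and integrable. -/
theorem ae_ne_bot_of_expectation_nonneg [IsFiniteMeasure μ] {f : Ω → EReal} (hf : Measurable f)
    {M : ℝ} (hM : ∀ ω, f ω ≤ M) (h : 0 ≤ expectation μ f) :
    (∀ᵐ ω ∂μ, f ω ≠ ⊥) ∧ Integrable (fun ω => (f ω).toReal) μ ∧
      expectation μ f = ((∫ ω, (f ω).toReal ∂μ : ℝ) : EReal) := by
  have hpos : ∫⁻ ω, (f ω).toENNReal ∂μ ≠ ⊤ := by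
    refine ne_top_of_le_ne_top (b := ENNReal.ofReal M * μ Set.univ)
      (ENNReal.mul_ne_top ENNReal.ofReal_ne_top (measure_ne_top _ _)) ?_
    rw [← lintegral_const]
    exact lintegral_mono fun ω => EReal.toENNReal_le_toENNReal (hM ω)
  have hneg : ∫⁻ ω, (-f ω).toENNReal ∂μ ≠ ⊤ := by
    intro htop
    rw [expectation, htop, EReal.coe_ennreal_top, EReal.sub_top, le_bot_iff] at h
    exact absurd h EReal.zero_ne_bot
  have hbot : ∀ᵐ ω ∂μ, f ω ≠ ⊥ := by
    filter_upwards [ae_lt_top hf.neg.ereal_toENNReal hneg] with ω hω h0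
    simp [h0] at hω
  have hcoe : ∀ᵐ ω ∂μ, f ω = ((f ω).toReal : EReal) := hbot.mono fun ω hω =>
    (EReal.coe_toReal (ne_top_of_le_ne_top (EReal.coe_ne_top _) (hM ω)) hω).symm
  have hint : Integrable (fun ω => (f ω).toReal) μ := by
    refine ((integrable_toReal_of_lintegral_ne_top hf.ereal_toENNReal.aemeasurable hpos).sub
      (integrable_toReal_of_lintegral_ne_top hf.neg.ereal_toENNReal.aemeasurable hneg)).congr ?_
    filter_upwards [hcoe] with ω hω
    generalize (f ω).toReal = r at hω
    simp only [Pi.sub_apply, Pi.neg_apply, hω]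
    rw [← EReal.coe_neg, EReal.real_coe_toENNReal, EReal.real_coe_toENNReal,
      ENNReal.toReal_ofReal', ENNReal.toReal_ofReal']
    exact max_zero_sub_max_neg_zero_eq_self r
  refine ⟨hbot, hint, ?_⟩
  rw [integral_eq_lintegral_toENNReal_sub hint]
  exact expectation_congr hcoe

end Expectation

/-! ### Mixed Nash equilibria -/

instance {n : ℕ} (s : Fin n → ProbabilityMeasure Message) :
    IsProbabilityMeasure (profileLaw s) := by
  unfold profileLaw; infer_instance

theorem integral_affine {Ω : Type*} [MeasurableSpace Ω] {μ : Measure Ω} [IsProbabilityMeasure μ]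
    {f : Ω → ℝ} (hf : Integrable f μ) (a c d : ℝ) :
    Integrable (fun ω => a + c * (f ω - d)) μ ∧
      ∫ ω, (a + c * (f ω - d)) ∂μ = a + c * (∫ ω, f ω ∂μ - d) := by
  have h : Integrable (fun ω => f ω - d) μ := hf.sub (integrable_const d)
  have h' : Integrable (fun ω => c * (f ω - d)) μ := h.const_mul c
  refine ⟨(integrable_const a).add h', ?_⟩
  rw [integral_add (integrable_const a) h', integral_const_mul,
    integral_sub hf (integrable_const d)]
  simp

theorem measurable_clicks {n m : ℕ} (φ : Fin n → Fin m → ℝ≥0) (i : Fin n) :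
    Measurable fun x : Allocation n m => clicks φ x i := by
  unfold clicks; fun_prop

theorem TieBreakingRule.measurable_clicks {n m : ℕ} {φ : Fin n → Fin m → ℝ≥0}
    (σ : TieBreakingRule φ) (i : Fin n) : Measurable fun b => clicks φ (σ.alloc b) i :=
  (Metagame.measurable_clicks φ i).comp σ.measurable_alloc

theorem TieBreakingRule.measurable_payment {n m : ℕ} {φ : Fin n → Fin m → ℝ≥0}
    (σ : TieBreakingRule φ) (i : Fin n) :
    Measurable fun b => payment (σ.price b) (σ.alloc b) i := by
  have h1 := σ.measurable_price
  have h2 := σ.measurable_alloc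
  unfold payment
  fun_prop

theorem measurable_payment_price {n m : ℕ} {φ : Fin n → Fin m → ℝ≥0}
    (σ : TieBreakingRule φ) (y : Allocation n m) (i : Fin n) :
    Measurable fun b => payment (σ.price b) y i := by
  have h1 := σ.measurable_price
  unfold payment
  fun_prop

theorem AgentType.integrable_value_clicks (T : AgentType) {n m : ℕ} (φ : Fin n → Fin m → ℝ≥0)
    {ν : Measure (Allocation n m)} [IsFiniteMeasure ν] (hν : ∀ᵐ x ∂ν, Allocation.IsFeasible x)
    (i : Fin n) : Integrable (fun x => T.value (clicks φ x i)) ν := by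
  refine Integrable.of_bound (C := T.value (∑ j, φ i j : ℝ≥0))
    (T.continuous_value.measurable.comp (measurable_clicks φ i)).aestronglyMeasurable ?_
  filter_upwards [hν] with x hx
  rw [Real.norm_of_nonneg (T.value_nonneg (NNReal.coe_nonneg _))]
  exact T.value_mono (NNReal.coe_nonneg _) (NNReal.coe_nonneg _)
    (NNReal.coe_le_coe.2 (clicks_le_of_le_one (hx.le_one i)))

namespace Market

variable {I : Market} {σ : TieBreakingRule I.ctr} {s : Fin I.n → ProbabilityMeasure Message}

theorem measurable_utility (I : Market) (σ : TieBreakingRule I.ctr) (i : Fin I.n) :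
    Measurable (I.utility σ i) := by
  have ht := σ.measurable_payment i
  refine Measurable.ite ((measurableSet_le ht measurable_const).inter
    (ht (measurableSet_singleton ⊤)).compl) ?_ measurable_const
  refine measurable_coe_real_ereal.comp (Measurable.sub ?_ ?_)
  · exact (I.agent i).continuous_value.measurable.comp (σ.measurable_clicks i)
  · exact (I.agent i).continuous_cost.measurable.comp (ht.ennreal_toNNReal)

theorem utility_le (I : Market) (σ : TieBreakingRule I.ctr) (i : Fin I.n)
    (b : Fin I.n → Message) :
    I.utility σ i b ≤ ((I.agent i).value (∑ j, I.ctr i j : ℝ≥0) : ℝ) := by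
  unfold Market.utility AgentType.utility
  split_ifs
  · have h1 := (I.agent i).cost_nonneg
      (ENNReal.toReal_nonneg (a := payment (σ.price b) (σ.alloc b) i))
    have h2 := (I.agent i).value_mono (NNReal.coe_nonneg _) (NNReal.coe_nonneg _)
      (NNReal.coe_le_coe.2 (clicks_le_of_le_one (φ := I.ctr)
        ((σ.isFPPE b).supply.le_one i)))
    exact EReal.coe_le_coe_iff.2 (by linarith)
  · exact bot_le

/-- A deviation to the budget `B` costs at most `C(B)`. -/
theorem le_utility_of_budget (I : Market) (σ : TieBreakingRule I.ctr) (i : Fin I.n)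
    {b : Fin I.n → Message} {B : ℝ≥0} (hB : (B : ℝ≥0∞) ≤ (I.agent i).budget)
    (hb : (b i).2 = B) :
    (((I.agent i).value (clicks I.ctr (σ.alloc b) i) - (I.agent i).cost B : ℝ) : EReal) ≤
      I.utility σ i b := by
  have hpay : payment (σ.price b) (σ.alloc b) i ≤ B := hb ▸ (σ.isFPPE b).budget_feasible i
  unfold Market.utility AgentType.utility
  rw [if_pos ⟨hpay.trans hB, ne_top_of_le_ne_top ENNReal.coe_ne_top hpay⟩]
  refine EReal.coe_le_coe_iff.2 (sub_le_sub_left ?_ _)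
  exact (I.agent i).cost_mono ENNReal.toReal_nonneg B.coe_nonneg
    (ENNReal.toReal_le_coe_of_le_coe hpay)

theorem IsMixedNash.expectation_nonneg (hs : I.IsMixedNash σ s) (i : Fin I.n) :
    0 ≤ expectation (profileLaw s) (I.utility σ i) := by
  refine le_trans ?_ (hs i (⊤, 0))
  have := integral_le_expectation (μ := profileLaw s)
    (f := fun b => I.utility σ i (Function.update b i (⊤, 0))) (g := fun _ => 0)
    (integrable_const _) (ae_of_all _ fun b => ?_)
  · simpa using this
  · refine le_trans ?_ (I.le_utility_of_budget σ i (B := 0) (by simp) (by simp))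
    refine EReal.coe_le_coe_iff.2 ?_
    rw [NNReal.coe_zero, (I.agent i).cost_zero, sub_zero]
    exact (I.agent i).value_nonneg (NNReal.coe_nonneg _)

theorem IsMixedNash.ae_payment (hs : I.IsMixedNash σ s) (i : Fin I.n) :
    ∀ᵐ b ∂profileLaw s, payment (σ.price b) (σ.alloc b) i ≤ (I.agent i).budget ∧
      payment (σ.price b) (σ.alloc b) i ≠ ⊤ := by
  filter_upwards [(ae_ne_bot_of_expectation_nonneg (I.measurable_utility σ i) (I.utility_le σ i)
    (hs.expectation_nonneg i)).1] with b hb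
  by_contra hc
  exact hb (if_neg hc)

theorem IsMixedNash.ae_price_ne_top (hs : I.IsMixedNash σ s) :
    ∀ᵐ b ∂profileLaw s, ∀ j, σ.price b j ≠ ⊤ := by
  filter_upwards [ae_all_iff.2 hs.ae_payment] with b hb
  have hsum := (σ.isFPPE b).sum_payment
  exact fun j => ENNReal.sum_ne_top.1 (hsum ▸ ENNReal.sum_ne_top.2 fun k _ => (hb k).2) j
    (Finset.mem_univ j)

theorem integrable_value_alloc (I : Market) (σ : TieBreakingRule I.ctr)
    (s : Fin I.n → ProbabilityMeasure Message) (i : Fin I.n) :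
    Integrable (fun b => (I.agent i).value (clicks I.ctr (σ.alloc b) i)) (profileLaw s) := by
  have hprob : IsProbabilityMeasure ((profileLaw s).map σ.alloc) :=
    Measure.isProbabilityMeasure_map σ.measurable_alloc.aemeasurable
  have hfeas : ∀ᵐ x ∂(profileLaw s).map σ.alloc, Allocation.IsFeasible x := by
    have hm : MeasurableSet {x : Allocation I.n I.m | x.IsFeasible} := by
      simp only [Allocation.IsFeasible, Set.ofPred_forall]
      exact MeasurableSet.iInter fun j => measurableSet_le (by fun_prop) measurable_const
    rw [ae_map_iff σ.measurable_alloc.aemeasurable hm]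
    exact ae_of_all _ fun b => (σ.isFPPE b).supply
  exact ((I.agent i).integrable_value_clicks I.ctr hfeas i).comp_measurable σ.measurable_alloc

/-- In equilibrium, the expected utility is the difference of the expected value and the expected
cost of the payment, both of which are finite. -/
theorem IsMixedNash.expectation_utility (hs : I.IsMixedNash σ s) (i : Fin I.n) :
    Integrable (fun b => (I.agent i).cost (payment (σ.price b) (σ.alloc b) i).toReal)
        (profileLaw s) ∧
      expectation (profileLaw s) (I.utility σ i) =
        ((∫ b, (I.agent i).value (clicks I.ctr (σ.alloc b) i) ∂profileLaw s -
          ∫ b, (I.agent i).cost (payment (σ.price b) (σ.alloc b) i).toReal ∂profileLaw s : ℝ) :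
          EReal) := by
  obtain ⟨-, hint, hexp⟩ := ae_ne_bot_of_expectation_nonneg (I.measurable_utility σ i)
    (I.utility_le σ i) (hs.expectation_nonneg i)
  have hV := I.integrable_value_alloc σ s i
  have hu : ∀ᵐ b ∂profileLaw s, (I.utility σ i b).toReal =
      (I.agent i).value (clicks I.ctr (σ.alloc b) i) -
        (I.agent i).cost (payment (σ.price b) (σ.alloc b) i).toReal :=
    (hs.ae_payment i).mono fun b hb => by
      rw [Market.utility, AgentType.utility, if_pos hb, EReal.toReal_coe]
  have hC : Integrable (fun b => (I.agent i).cost (payment (σ.price b) (σ.alloc b) i).toReal)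
      (profileLaw s) :=
    (hV.sub hint).congr (hu.mono fun b hb => by simp only [Pi.sub_apply, hb]; ring)
  refine ⟨hC, ?_⟩
  rw [hexp, integral_congr_ae hu, integral_sub hV hC]

theorem willingnessToPay_inducedAllocation (I : Market) (σ : TieBreakingRule I.ctr)
    (s : Fin I.n → ProbabilityMeasure Message) (i : Fin I.n) :
    I.willingnessToPay (I.inducedAllocation σ s) i = min (I.agent i).budget
      ((I.agent i).costInv
        (∫ b, (I.agent i).value (clicks I.ctr (σ.alloc b) i) ∂profileLaw s)) := by
  rw [willingnessToPay, inducedAllocation, integral_map σ.measurable_alloc.aemeasurable]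
  exact ((I.agent i).continuous_value.measurable.comp
    (measurable_clicks I.ctr i)).aestronglyMeasurable

/-- The expected payment is at most the willingness to pay: payments respect the hard budget, and
their expected cost is at most the expected value, so Jensen's inequality applies to the cost. -/
theorem IsMixedNash.lintegral_payment_le (hs : I.IsMixedNash σ s) (i : Fin I.n) :
    ∫⁻ b, payment (σ.price b) (σ.alloc b) i ∂profileLaw s ≤
      I.willingnessToPay (I.inducedAllocation σ s) i := by
  rw [willingnessToPay_inducedAllocation]
  refine le_min ?_ ?_
  · calc ∫⁻ b, payment (σ.price b) (σ.alloc b) i ∂profileLaw s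
        ≤ ∫⁻ _, (I.agent i).budget ∂profileLaw s :=
          lintegral_mono_ae ((hs.ae_payment i).mono fun b hb => hb.1)
      _ = (I.agent i).budget := by simp
  · set T := I.agent i
    set v := ∫ b, T.value (clicks I.ctr (σ.alloc b) i) ∂profileLaw s
    by_contra! hlt
    obtain ⟨B, hB, hBt⟩ := ENNReal.lt_iff_exists_nnreal_btwn.1 hlt
    have hv : v < T.cost B := T.lt_cost_of_costInv_lt hB
    have hv0 : 0 ≤ v := integral_nonneg fun b => T.value_nonneg (NNReal.coe_nonneg _)
    obtain ⟨c, hc, htan⟩ := T.exists_tangent (hv0.trans_lt hv)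
    obtain ⟨hC, hexp⟩ := hs.expectation_utility i
    have hCv : ∫ b, T.cost (payment (σ.price b) (σ.alloc b) i).toReal ∂profileLaw s ≤ v := by
      have := hs.expectation_nonneg i
      rw [hexp] at this
      exact sub_nonneg.1 (EReal.coe_nonneg.1 this)
    have hbound : ∀ b, (payment (σ.price b) (σ.alloc b) i).toReal ≤
        B + c⁻¹ * (T.cost (payment (σ.price b) (σ.alloc b) i).toReal - T.cost B) := by
      intro b
      have := htan (payment (σ.price b) (σ.alloc b) i).toNNReal
      rw [ENNReal.coe_toNNReal_eq_toReal] at this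
      rw [← sub_le_iff_le_add', le_inv_mul_iff₀ hc]
      linarith
    obtain ⟨hintR, haff⟩ := integral_affine hC B c⁻¹ (T.cost B)
    have hle : ∫⁻ b, payment (σ.price b) (σ.alloc b) i ∂profileLaw s ≤
        ∫⁻ b, ENNReal.ofReal (B + c⁻¹ *
          (T.cost (payment (σ.price b) (σ.alloc b) i).toReal - T.cost B)) ∂profileLaw s := by
      refine lintegral_mono_ae ((hs.ae_payment i).mono fun b hb => ?_)
      rw [← ENNReal.ofReal_toReal hb.2]
      exact ENNReal.ofReal_le_ofReal (by simpa using hbound b)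
    rw [← ofReal_integral_eq_lintegral_ofReal hintR
      (ae_of_all _ fun b => ENNReal.toReal_nonneg.trans (hbound b)), haff] at hle
    refine absurd (hBt.trans_le hle) (not_lt.2 ?_)
    rw [← ENNReal.ofReal_coe_nnreal]
    refine ENNReal.ofReal_le_ofReal ?_
    have : c⁻¹ * (∫ b, T.cost (payment (σ.price b) (σ.alloc b) i).toReal ∂profileLaw s
        - T.cost B) ≤ 0 :=
      mul_nonpos_of_nonneg_of_nonpos (inv_nonneg.2 hc.le) (by linarith)
    linarith

/-- No agent gains by buying at the budget `B`: at expected equilibrium prices `P` of the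
bundle `y i`, this would supply a fraction `B / (P + B)` of it. -/
theorem IsMixedNash.value_mul_le (hs : I.IsMixedNash σ s) (i : Fin I.n)
    {y : Allocation I.n I.m} (hy : ∀ j, y i j ≤ 1) {B : ℝ≥0} (hB0 : 0 < B)
    (hB : (B : ℝ≥0∞) ≤ (I.agent i).budget) {P : ℝ≥0}
    (hP : ∫⁻ b, payment (σ.price b) y i ∂profileLaw s = P) :
    (I.agent i).value (clicks I.ctr y i) * (B / (P + B)) - (I.agent i).cost B ≤
      ∫ b, (I.agent i).value (clicks I.ctr (σ.alloc b) i) ∂profileLaw s := by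
  set T := I.agent i
  set q : (Fin I.n → Message) → ℝ := fun b => (payment (σ.price b) y i).toReal
  have hmeas := measurable_payment_price σ y i
  have hPtop : ∫⁻ b, payment (σ.price b) y i ∂profileLaw s ≠ ⊤ := hP ▸ ENNReal.coe_ne_top
  have hq : Integrable q (profileLaw s) :=
    integrable_toReal_of_lintegral_ne_top hmeas.aemeasurable hPtop
  have hqint : ∫ b, q b ∂profileLaw s = P := by
    rw [integral_toReal hmeas.aemeasurable (ae_lt_top hmeas hPtop), hP, ENNReal.coe_toReal]
  have hB0' : (0 : ℝ) < B := hB0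
  have hPB : (0 : ℝ) < P + B := add_pos_of_nonneg_of_pos P.coe_nonneg hB0'
  have hV0 : 0 ≤ T.value (clicks I.ctr y i) := T.value_nonneg (NNReal.coe_nonneg _)
  -- The deviation is bounded below through the tangent at `P` of the convex function
  -- `q ↦ B / (q + B)`, so that only the expectation of the price matters.
  set g : (Fin I.n → Message) → ℝ := fun b =>
    T.value (clicks I.ctr y i) * (B / (P + B)) - T.cost B +
      -(T.value (clicks I.ctr y i) * (B / (P + B) ^ 2)) * (q b - P)
  obtain ⟨hg, hgint⟩ : Integrable g (profileLaw s) ∧ _ := integral_affine hq _ _ _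
  rw [hqint, sub_self, mul_zero, add_zero] at hgint
  have hdev : ∀ᵐ b ∂profileLaw s,
      (g b : EReal) ≤ I.utility σ i (Function.update b i (⊤, (B : ℝ≥0∞))) := by
    filter_upwards [hs.ae_price_ne_top, ae_lt_top hmeas hPtop] with b hb hqb
    refine le_trans (EReal.coe_le_coe_iff.2 ?_)
      (I.le_utility_of_budget σ i (B := B) hB (by simp))
    set b' := Function.update b i (⊤, (B : ℝ≥0∞))
    have hclicks := (σ.isFPPE b).clicks_mul_le_of_deviation (σ.isFPPE b') (i := i)
      (fun k hk => Function.update_of_ne hk _ _) hb (B := B) (Function.update_self _ _ _) hy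
    have hq0 : 0 ≤ q b := ENNReal.toReal_nonneg
    have hqB : 0 < q b + B := add_pos_of_nonneg_of_pos hq0 hB0'
    have hreal : (clicks I.ctr y i : ℝ) * B ≤ clicks I.ctr (σ.alloc b') i * (q b + B) := by
      have := ENNReal.toReal_mono (ENNReal.mul_ne_top ENNReal.coe_ne_top
        (ENNReal.add_ne_top.2 ⟨hqb.ne, ENNReal.coe_ne_top⟩)) hclicks
      simpa [ENNReal.toReal_mul, ENNReal.toReal_add hqb.ne] using this
    have htangent : (B : ℝ) / (P + B) - B / (P + B) ^ 2 * (q b - P) ≤ B / (q b + B) := by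
      have : (B : ℝ) / (q b + B) - (B / (P + B) - B / (P + B) ^ 2 * (q b - P)) =
          B * (q b - P) ^ 2 / ((P + B) ^ 2 * (q b + B)) := by
        field_simp
        ring
      have : (0 : ℝ) ≤ B * (q b - P) ^ 2 / ((P + B) ^ 2 * (q b + B)) := by positivity
      linarith
    suffices h : T.value (clicks I.ctr y i) * (B / (P + B) - B / (P + B) ^ 2 * (q b - P)) ≤
        T.value (clicks I.ctr (σ.alloc b') i) by
      simp only [g]
      linarith
    calc T.value (clicks I.ctr y i) * (B / (P + B) - B / (P + B) ^ 2 * (q b - P))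
        ≤ T.value (clicks I.ctr y i) * (B / (q b + B)) := by gcongr
      _ = B / (q b + B) * T.value (clicks I.ctr y i) := mul_comm _ _
      _ ≤ T.value (B / (q b + B) * clicks I.ctr y i) :=
          T.mul_value_le (by positivity) ((div_le_one hqB).2 (by linarith))
            (NNReal.coe_nonneg _)
      _ ≤ T.value (clicks I.ctr (σ.alloc b') i) := by
          refine T.value_mono (Set.mem_Ici.2 (by positivity)) (NNReal.coe_nonneg _) ?_
          rw [div_mul_eq_mul_div, div_le_iff₀ hqB]
          linarith
  have hle := (integral_le_expectation hg hdev).trans (hs i (⊤, (B : ℝ≥0∞)))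
  obtain ⟨hC, hexp⟩ := hs.expectation_utility i
  rw [hgint, hexp, EReal.coe_le_coe_iff] at hle
  have hC0 : 0 ≤ ∫ b, T.cost (payment (σ.price b) (σ.alloc b) i).toReal ∂profileLaw s :=
    integral_nonneg fun b => T.cost_nonneg ENNReal.toReal_nonneg
  linarith

end Market

/-! ### The upper bound -/

/-- The expected allocation, a deterministic allocation. -/
noncomputable def meanAllocation {n m : ℕ} (ν : Measure (Allocation n m)) : Allocation n m :=
  fun i j => (∫ x, (x i j : ℝ) ∂ν).toNNReal

section MeanAllocation

variable {n m : ℕ} {ν : Measure (Allocation n m)} [IsProbabilityMeasure ν]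

theorem integrable_alloc (hν : ∀ᵐ x ∂ν, Allocation.IsFeasible x) (i : Fin n) (j : Fin m) :
    Integrable (fun x : Allocation n m => (x i j : ℝ)) ν := by
  refine Integrable.of_bound (C := 1) (Measurable.aestronglyMeasurable (by fun_prop)) ?_
  filter_upwards [hν] with x hx
  simpa using hx.le_one i j

theorem coe_meanAllocation (ν : Measure (Allocation n m)) (i : Fin n) (j : Fin m) :
    (meanAllocation ν i j : ℝ) = ∫ x, (x i j : ℝ) ∂ν :=
  Real.coe_toNNReal _ (integral_nonneg fun _ => NNReal.coe_nonneg _)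

theorem meanAllocation_isFeasible (hν : ∀ᵐ x ∂ν, Allocation.IsFeasible x) :
    (meanAllocation ν).IsFeasible := by
  intro j
  rw [← NNReal.coe_le_coe, NNReal.coe_sum]
  simp only [coe_meanAllocation]
  rw [← integral_finsetSum _ fun i _ => integrable_alloc hν i j]
  calc ∫ x, ∑ i, (x i j : ℝ) ∂ν ≤ ∫ _, (1 : ℝ) ∂ν := by
        refine integral_mono_ae (integrable_finsetSum _ fun i _ => integrable_alloc hν i j)
          (integrable_const _) ?_
        filter_upwards [hν] with x hx
        have := hx j
        rw [← NNReal.coe_le_coe, NNReal.coe_sum] at this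
        exact this
    _ = ((1 : ℝ≥0) : ℝ) := by simp

theorem AgentType.integral_value_le (T : AgentType) (φ : Fin n → Fin m → ℝ≥0)
    (hν : ∀ᵐ x ∂ν, Allocation.IsFeasible x) (i : Fin n) :
    ∫ x, T.value (clicks φ x i) ∂ν ≤ T.value (clicks φ (meanAllocation ν) i) := by
  have hterm : ∀ j, Integrable (fun x : Allocation n m => (φ i j : ℝ) * x i j) ν := fun j =>
    (integrable_alloc hν i j).const_mul _
  have hcl : ∀ x : Allocation n m, (clicks φ x i : ℝ) = ∑ j, (φ i j : ℝ) * x i j := fun x => by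
    simp [clicks]
  have hint : Integrable (fun x => (clicks φ x i : ℝ)) ν := by
    simp only [hcl]
    exact integrable_finsetSum _ fun j _ => hterm j
  have hmean : (clicks φ (meanAllocation ν) i : ℝ) = ∫ x, (clicks φ x i : ℝ) ∂ν := by
    simp only [hcl]
    rw [integral_finsetSum _ fun j _ => hterm j]
    exact Finset.sum_congr rfl fun j _ => by rw [coe_meanAllocation, integral_const_mul]
  rw [hmean]
  exact T.value_concave.le_map_integral T.value_diff.continuousOn isClosed_Ici
    (ae_of_all _ fun x => NNReal.coe_nonneg _) hint (T.integrable_value_clicks φ hν i)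

end MeanAllocation

namespace Market

variable {I : Market} {σ : TieBreakingRule I.ctr} {s : Fin I.n → ProbabilityMeasure Message}

/-- A budget `B` above the equilibrium willingness to pay costs more than the equilibrium value.
If the bundle `y i` is worth a payment `t ≥ B`, convexity of the cost turns the unprofitability of
the deviation to `B` into `t ≤ 2 (P + B)`, where `P` is the expected equilibrium price of `y i`. -/
theorem IsMixedNash.willingnessToPay_le (hs : I.IsMixedNash σ s) (i : Fin I.n)
    {y : Allocation I.n I.m} (hy : ∀ j, y i j ≤ 1) :
    min (I.agent i).budget ((I.agent i).costInv ((I.agent i).value (clicks I.ctr y i))) ≤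
      2 * (∫⁻ b, payment (σ.price b) y i ∂profileLaw s +
        I.willingnessToPay (I.inducedAllocation σ s) i) := by
  by_contra! hlt
  rw [willingnessToPay_inducedAllocation] at hlt
  set T := I.agent i
  set v := ∫ b, T.value (clicks I.ctr (σ.alloc b) i) ∂profileLaw s
  obtain ⟨t, ht, htmin⟩ := ENNReal.lt_iff_exists_nnreal_btwn.1 hlt
  have hPtop : ∫⁻ b, payment (σ.price b) y i ∂profileLaw s ≠ ⊤ := by
    rintro h
    simp [h] at ht
  obtain ⟨P, hP⟩ : ∃ P : ℝ≥0, (P : ℝ≥0∞) = ∫⁻ b, payment (σ.price b) y i ∂profileLaw s :=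
    ⟨_, ENNReal.coe_toNNReal hPtop⟩
  rw [← hP] at ht
  obtain ⟨B, hWB, hBt⟩ : ∃ B : ℝ≥0, min T.budget (T.costInv v) < B ∧ 2 * (P + B) < t := by
    have h1 : min T.budget (T.costInv v) < (t : ℝ≥0∞) / 2 - P := by
      rw [lt_tsub_iff_left, ENNReal.lt_div_iff_mul_lt (by simp) (by simp), mul_comm]
      exact ht
    obtain ⟨B, hB, hB'⟩ := ENNReal.lt_iff_exists_nnreal_btwn.1 h1
    refine ⟨B, hB, ?_⟩
    rw [lt_tsub_iff_left, ENNReal.lt_div_iff_mul_lt (by simp) (by simp), mul_comm] at hB'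
    exact_mod_cast hB'
  have hBt' : (B : ℝ≥0∞) ≤ t := by
    have : B ≤ 2 * (P + B) := by
      rw [two_mul]; exact le_add_right (le_add_left le_rfl)
    exact_mod_cast this.trans hBt.le
  have hBbud : (B : ℝ≥0∞) < T.budget := hBt'.trans_lt (htmin.trans_le (min_le_left _ _))
  have hcost : v < T.cost B := by
    refine T.lt_cost_of_costInv_lt ?_
    rcases min_lt_iff.1 hWB with h | h
    · exact absurd h (not_lt.2 hBbud.le)
    · exact h
  have hB0 : 0 < B := by
    have : (0 : ℝ≥0∞) < B := zero_le.trans_lt hWB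
    exact_mod_cast this
  have hval : T.cost t ≤ T.value (clicks I.ctr y i) :=
    T.cost_le_of_lt_costInv (htmin.trans_le (min_le_right _ _))
  have hdev := hs.value_mul_le i hy hB0 hBbud.le hP.symm
  have hv0 : 0 ≤ v := integral_nonneg fun b => T.value_nonneg (NNReal.coe_nonneg _)
  have hconv := T.mul_cost_le B.coe_nonneg (NNReal.coe_le_coe.2 (ENNReal.coe_le_coe.1 hBt'))
  have hB0' : (0 : ℝ) < B := hB0
  have hPB : (0 : ℝ) < P + B := add_pos_of_nonneg_of_pos P.coe_nonneg hB0'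
  have hBt2 : 2 * ((P : ℝ) + B) < t := by exact_mod_cast hBt
  have h1 : T.value (clicks I.ctr y i) * (B / (P + B)) < 2 * T.cost B := by linarith
  rw [mul_div_assoc', div_lt_iff₀ hPB] at h1
  have h2 : T.cost t * B ≤ T.value (clicks I.ctr y i) * B := by gcongr
  have h3 : 2 * ((P : ℝ) + B) * T.cost B ≤ t * T.cost B := by
    have := hv0.trans_lt hcost
    gcongr
  linarith

/-- The willingness to pay for the bundles `y i` exceeds the equilibrium one by at most the price
of `y`, up to the factor 2, and all prices are paid by the agents. -/
theorem IsMixedNash.liquidWelfare_le (hs : I.IsMixedNash σ s) (ν : Measure (Allocation I.n I.m))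
    [IsProbabilityMeasure ν] (hν : ∀ᵐ x ∂ν, Allocation.IsFeasible x) :
    I.liquidWelfare ν ≤ 4 * I.liquidWelfare (I.inducedAllocation σ s) := by
  have hy := meanAllocation_isFeasible hν
  set y := meanAllocation ν
  have hrev : ∑ i, ∫⁻ b, payment (σ.price b) y i ∂profileLaw s ≤
      I.liquidWelfare (I.inducedAllocation σ s) :=
    calc ∑ i, ∫⁻ b, payment (σ.price b) y i ∂profileLaw s
        = ∫⁻ b, ∑ i, payment (σ.price b) y i ∂profileLaw s :=
          (lintegral_finsetSum _ fun i _ => measurable_payment_price σ y i).symm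
      _ ≤ ∫⁻ b, ∑ i, payment (σ.price b) (σ.alloc b) i ∂profileLaw s := by
          refine lintegral_mono fun b => ?_
          rw [(σ.isFPPE b).sum_payment]
          unfold payment
          rw [Finset.sum_comm]
          refine Finset.sum_le_sum fun j _ => ?_
          rw [← Finset.sum_mul]
          refine mul_le_of_le_one_left zero_le ?_
          rw [← ENNReal.ofNNReal_finsetSum]
          exact ENNReal.coe_le_one_iff.2 (hy j)
      _ = ∑ i, ∫⁻ b, payment (σ.price b) (σ.alloc b) i ∂profileLaw s :=
          lintegral_finsetSum _ fun i _ => σ.measurable_payment i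
      _ ≤ _ := Finset.sum_le_sum fun i _ => hs.lintegral_payment_le i
  calc I.liquidWelfare ν
      ≤ ∑ i, 2 * (∫⁻ b, payment (σ.price b) y i ∂profileLaw s +
          I.willingnessToPay (I.inducedAllocation σ s) i) :=
        Finset.sum_le_sum fun i _ =>
          (min_le_min_left _ ((I.agent i).costInv_mono
            ((I.agent i).integral_value_le I.ctr hν i))).trans
            (hs.willingnessToPay_le i (hy.le_one i))
    _ = 2 * (∑ i, ∫⁻ b, payment (σ.price b) y i ∂profileLaw s +
          I.liquidWelfare (I.inducedAllocation σ s)) := by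
        rw [← Finset.mul_sum, Finset.sum_add_distrib]; rfl
    _ ≤ 2 * (I.liquidWelfare (I.inducedAllocation σ s) +
          I.liquidWelfare (I.inducedAllocation σ s)) := by gcongr
    _ = _ := by ring

theorem optimalWelfare_le (hs : I.IsMixedNash σ s) :
    I.optimalWelfare ≤ 4 * I.liquidWelfare (I.inducedAllocation σ s) :=
  iSup₂_le fun x hx => hs.liquidWelfare_le (Measure.dirac x) (by
    rw [ae_dirac_eq]
    exact hx)

end Market

theorem mixedPoA_le (σ : ∀ (n m : ℕ) (φ : Fin n → Fin m → ℝ≥0), TieBreakingRule φ) :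
    mixedPoA σ ≤ 4 := by
  refine iSup_le fun I => ENNReal.div_le_of_le_mul ?_
  simp only [ENNReal.mul_iInf_of_ne (show (4 : ℝ≥0∞) ≠ 0 by simp) (show (4 : ℝ≥0∞) ≠ ⊤ by simp)]
  exact le_iInf₂ fun s hs => Market.optimalWelfare_le hs

/-! ### The lower bound -/

/-- Value `a` per click, money cost equal to the payment, and hard budget `w`. -/
noncomputable def AgentType.linear (a : ℝ≥0) (w : ℝ≥0∞) : AgentType where
  value z := a * z
  budget := w
  cost t := t
  value_zero := mul_zero _
  value_mono := fun _ _ _ _ h => mul_le_mul_of_nonneg_left h a.coe_nonneg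
  value_concave := (concaveOn_id (convex_Ici 0)).smul a.coe_nonneg
  value_diff := (differentiable_id.const_mul _).differentiableOn
  cost_zero := rfl
  cost_mono := fun _ _ _ _ h => h
  cost_convex := convexOn_id (convex_Ici 0)
  cost_diff := differentiable_id.differentiableOn
  budget_or_cost := Or.inr ⟨1, zero_le_one, zero_lt_one⟩

theorem AgentType.costInv_linear (a : ℝ≥0) (w : ℝ≥0∞) (y : ℝ≥0) :
    (AgentType.linear a w).costInv y = y :=
  le_antisymm (iSup₂_le fun _ ht => ENNReal.coe_le_coe.2 (NNReal.coe_le_coe.1 ht))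
    (AgentType.le_costInv _ (le_refl (y : ℝ)))

/-- One item; agent `0` has value `1` per click and no hard budget, agent `1` has the large value
`ε⁻¹` per click and hard budget `1`. -/
noncomputable abbrev tightMarket (ε : ℝ≥0) : Market where
  n := 2
  m := 1
  two_le_n := le_rfl
  ctr _ _ := 1
  agent := ![AgentType.linear 1 ⊤, AgentType.linear ε⁻¹ 1]

/-- Agent `0` bids her true value without a budget; agent `1` spends her hard budget whatever the
price. -/
def tightProfile : Fin 2 → Message := ![(1, ⊤), (⊤, 1)]

section OneItem

variable {b : Fin 2 → Message} {p : Fin 1 → ℝ≥0∞} {x : Allocation 2 1}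

theorem clicks_one_item (x : Allocation 2 1) (i : Fin 2) :
    clicks (fun _ _ => 1) x i = x i 0 := by simp [clicks]

theorem payment_one_item (p : Fin 1 → ℝ≥0∞) (x : Allocation 2 1) (i : Fin 2) :
    payment p x i = x i 0 * p 0 := by simp [payment]

theorem one_le_price_of_zero (h : IsFPPE (fun _ _ => 1) b p x) (hb : b 0 = (1, ⊤)) :
    1 ≤ p 0 := by
  by_contra! hlt
  have hpay := h.budget_exhausted 0 ⟨0, by simpa [hb] using hlt⟩
  rw [hb, payment_one_item] at hpay
  exact ENNReal.mul_ne_top ENNReal.coe_ne_top (hlt.trans ENNReal.one_lt_top).ne hpay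

theorem one_le_price_of_one (h : IsFPPE (fun _ _ => 1) b p x) (hb : b 1 = (⊤, 1)) :
    1 ≤ p 0 := by
  by_contra! hlt
  have hpay := h.budget_exhausted 1 ⟨0, by simpa [hb] using hlt.trans ENNReal.one_lt_top⟩
  have hsum := h.sum_payment
  rw [Fin.sum_univ_two, hpay, hb] at hsum
  simp only [Finset.univ_unique, Fin.default_eq_zero, Finset.sum_singleton] at hsum
  exact absurd hlt (not_lt.2 (hsum ▸ le_add_left le_rfl))

theorem outcome_tightProfile (h : IsFPPE (fun _ _ => 1) tightProfile p x) :
    p 0 = 1 ∧ x 0 0 = 0 ∧ x 1 0 = 1 := by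
  have hp : 1 ≤ p 0 := one_le_price_of_zero h rfl
  have hsold : x 0 0 + x 1 0 = 1 := by
    simpa [Fin.sum_univ_two] using h.sold_out 0 (zero_lt_one.trans_le hp)
  have hbud : (x 1 0 : ℝ≥0∞) * p 0 ≤ 1 := by
    simpa [tightProfile, payment_one_item] using h.budget_feasible 1
  have hx0 : x 0 0 = 0 := by
    by_contra hne
    have hp1 : p 0 = 1 := le_antisymm
      (by simpa [tightProfile] using h.price_le_value 0 0 (pos_iff_ne_zero.2 hne)) hp
    have hpay := h.budget_exhausted 1 ⟨0, by simp [tightProfile, hp1]⟩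
    have hx1 : x 1 0 = 1 := by simpa [tightProfile, payment_one_item, hp1] using hpay
    rw [hx1] at hsold
    exact hne (by simpa using hsold)
  have hx1 : x 1 0 = 1 := by simpa [hx0] using hsold
  exact ⟨le_antisymm (by simpa [hx1] using hbud) hp, hx0, hx1⟩

/-- At a price of at least `1`, an agent with value `a ≥ 1` per click and hard budget `w` gains at
most `(a - 1) w`. -/
theorem utility_linear_le {a : ℝ≥0} {w : ℝ≥0∞} {c : ℝ} {i : Fin 2} (hp : 1 ≤ p 0) (ha : 1 ≤ a)
    (hw : ∀ t : ℝ≥0, (t : ℝ≥0∞) ≤ w → (a - 1 : ℝ) * t ≤ c) :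
    (AgentType.linear a w).utility (x i 0) (payment p x i) ≤ c := by
  unfold AgentType.utility
  split_ifs with hpay
  · obtain ⟨t, ht⟩ : ∃ t : ℝ≥0, (t : ℝ≥0∞) = payment p x i := ⟨_, ENNReal.coe_toNNReal hpay.2⟩
    have hxt : (x i 0 : ℝ≥0∞) ≤ t := by
      rw [ht, payment_one_item]
      exact le_mul_of_one_le_right zero_le hp
    have hxt' : (x i 0 : ℝ) ≤ t := NNReal.coe_le_coe.2 (ENNReal.coe_le_coe.1 hxt)
    have hc := hw t (ht ▸ hpay.1)
    rw [← ht, ENNReal.coe_toReal]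
    refine EReal.coe_le_coe_iff.2 ?_
    change (a : ℝ) * x i 0 - t ≤ c
    have : (a : ℝ) * x i 0 ≤ a * t := by gcongr
    linarith
  · exact bot_le

end OneItem

theorem expectation_dirac {n : ℕ} (e : Fin n → Message) (f : (Fin n → Message) → EReal) :
    expectation (Measure.dirac e) f = f e := by
  rw [expectation, lintegral_dirac, lintegral_dirac, EReal.coe_toENNReal_eq_max,
    EReal.coe_toENNReal_eq_max]
  induction f e with
  | bot => simp
  | top => simp
  | coe r =>
    rcases le_total 0 r with h | h
    · rw [max_eq_right (by exact_mod_cast h), max_eq_left (by simpa using h), sub_zero]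
    · rw [max_eq_left (by exact_mod_cast h), max_eq_right (by simpa using h)]
      simp

/-- The pure message profile `e` as a profile of degenerate mixed messages. -/
noncomputable def pureProfile {n : ℕ} (e : Fin n → Message) : Fin n → ProbabilityMeasure Message :=
  fun i => ⟨Measure.dirac (e i), inferInstance⟩

theorem profileLaw_pureProfile {n : ℕ} (e : Fin n → Message) :
    profileLaw (pureProfile e) = Measure.dirac e := by
  refine Measure.pi_eq fun t ht => ?_
  rw [Measure.dirac_apply' _ (MeasurableSet.univ_pi ht)]
  simp only [pureProfile, ProbabilityMeasure.coe_mk]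
  by_cases he : e ∈ Set.univ.pi t
  · rw [Set.indicator_of_mem he, Pi.one_apply, Finset.prod_eq_one]
    intro i _
    simp [Measure.dirac_apply' _ (ht i), he i (Set.mem_univ i)]
  · obtain ⟨i, hi⟩ : ∃ i, e i ∉ t i := by simpa [Set.mem_univ_pi] using he
    rw [Set.indicator_of_notMem he, Finset.prod_eq_zero (Finset.mem_univ i)]
    simp [Measure.dirac_apply' _ (ht i), hi]

theorem isMixedNash_tightProfile {ε : ℝ≥0} (hε : 0 < ε) (hε1 : ε ≤ 1)
    (σ : TieBreakingRule (tightMarket ε).ctr) :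
    (tightMarket ε).IsMixedNash σ (pureProfile tightProfile) := by
  have hout := outcome_tightProfile (σ.isFPPE tightProfile)
  have key : ∀ (i : Fin 2) (d : Message),
      (tightMarket ε).utility σ i (Function.update tightProfile i d) ≤
        (tightMarket ε).utility σ i tightProfile := by
    intro i d
    have hu : ∀ b, (tightMarket ε).utility σ i b = ((tightMarket ε).agent i).utility
        (σ.alloc b i 0) (payment (σ.price b) (σ.alloc b) i) := fun b => by
      rw [Market.utility]; congr 1; exact clicks_one_item _ _
    rw [hu, hu, payment_one_item (σ.price tightProfile), hout.1]
    have hF := σ.isFPPE (Function.update tightProfile i d)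
    fin_cases i
    · refine le_trans (utility_linear_le (c := 0) (one_le_price_of_one hF rfl) le_rfl
        (by simp)) ?_
      simp [tightMarket, AgentType.linear, AgentType.utility, hout.2.1]
    · refine le_trans (utility_linear_le (c := (ε⁻¹ : ℝ≥0) - 1) (one_le_price_of_zero hF rfl)
        ((one_le_inv₀ hε).2 hε1) ?_) ?_
      · intro t ht
        refine mul_le_of_le_one_right (sub_nonneg.2 ?_) (by exact_mod_cast ht)
        exact_mod_cast (one_le_inv₀ hε).2 hε1
      · simp [tightMarket, AgentType.linear, AgentType.utility, hout.2.2]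
  intro i d
  rw [profileLaw_pureProfile, expectation_dirac, expectation_dirac]
  exact key i d

theorem liquidWelfare_tightProfile_le (ε : ℝ≥0) (σ : TieBreakingRule (tightMarket ε).ctr) :
    (tightMarket ε).liquidWelfare
      ((tightMarket ε).inducedAllocation σ (pureProfile tightProfile)) ≤ 1 := by
  have hout := outcome_tightProfile (σ.isFPPE tightProfile)
  have h0 : (tightMarket ε).willingnessToPay
      ((tightMarket ε).inducedAllocation σ (pureProfile tightProfile)) 0 = 0 := by
    rw [Market.willingnessToPay_inducedAllocation, profileLaw_pureProfile, integral_dirac,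
      clicks_one_item, hout.2.1]
    have := AgentType.costInv_linear 1 ⊤ 0
    simp_all [AgentType.linear]
  rw [Market.liquidWelfare, Fin.sum_univ_two, h0, zero_add]
  exact min_le_left _ _

theorem le_optimalWelfare_tightMarket {ε : ℝ≥0} (hε : 0 < ε) (hε1 : ε ≤ 1) :
    2 - (ε : ℝ≥0∞) ≤ (tightMarket ε).optimalWelfare := by
  set x : Allocation 2 1 := ![fun _ => 1 - ε, fun _ => ε]
  have hx : x.IsFeasible := fun j => by
    simp [x, Fin.sum_univ_two, tsub_add_cancel_of_le hε1]
  refine le_trans ?_ (le_iSup₂_of_le (ι := Allocation 2 1) x hx le_rfl)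
  have h0 : (1 - ε : ℝ≥0) ≤ (tightMarket ε).willingnessToPay (Measure.dirac x) 0 := by
    rw [Market.willingnessToPay, integral_dirac, clicks_one_item]
    refine le_min le_top (AgentType.le_costInv _ ?_)
    simp [AgentType.linear, x]
  have h1 : 1 ≤ (tightMarket ε).willingnessToPay (Measure.dirac x) 1 := by
    rw [Market.willingnessToPay, integral_dirac, clicks_one_item]
    refine le_min le_rfl (AgentType.le_costInv _ (t := 1) ?_)
    simp [AgentType.linear, x, hε.ne']
  rw [Market.liquidWelfare, Fin.sum_univ_two]
  calc 2 - (ε : ℝ≥0∞) ≤ (1 - ε : ℝ≥0) + 1 := by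
        rw [tsub_le_iff_right, ENNReal.coe_sub, add_right_comm, ENNReal.coe_one,
          tsub_add_cancel_of_le (by exact_mod_cast hε1), one_add_one_eq_two]
    _ ≤ _ := add_le_add h0 h1

theorem two_le_mixedPoA (σ : ∀ (n m : ℕ) (φ : Fin n → Fin m → ℝ≥0), TieBreakingRule φ) :
    2 ≤ mixedPoA σ := by
  refine ENNReal.le_of_forall_pos_le_add fun ε hε _ => ?_
  have h0 : 0 < min ε 1 := lt_min hε one_pos
  rw [← tsub_le_iff_right]
  calc (2 : ℝ≥0∞) - ε ≤ 2 - (min ε 1 : ℝ≥0) :=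
        tsub_le_tsub_left (ENNReal.coe_le_coe.2 (min_le_left _ _)) _
    _ ≤ (tightMarket (min ε 1)).optimalWelfare :=
        le_optimalWelfare_tightMarket h0 (min_le_right _ _)
    _ = (tightMarket (min ε 1)).optimalWelfare / 1 := (div_one _).symm
    _ ≤ _ := ENNReal.div_le_div_left ((iInf₂_le _ (isMixedNash_tightProfile h0
        (min_le_right _ _) _)).trans (liquidWelfare_tightProfile_le _ _)) _
    _ ≤ mixedPoA σ := le_iSup (fun I : Market => I.optimalWelfare /
        ⨅ (s : Fin I.n → ProbabilityMeasure Message) (_ : I.IsMixedNash (σ I.n I.m I.ctr) s),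
          I.liquidWelfare (I.inducedAllocation (σ I.n I.m I.ctr) s)) (tightMarket (min ε 1))

end Metagame

open Metagame in
theorem theorem5p1 :
    (∀ (I : Market) (σ : TieBreakingRule I.ctr)
        (s : Fin I.n → MeasureTheory.ProbabilityMeasure Message), I.IsMixedNash σ s →
      ∀ ν : MeasureTheory.Measure (Allocation I.n I.m), MeasureTheory.IsProbabilityMeasure ν →
        (∀ᵐ x ∂ν, Allocation.IsFeasible x) →
        I.liquidWelfare ν ≤ 4 * I.liquidWelfare (I.inducedAllocation σ s)) ∧
    (∀ σ : ∀ (n m : ℕ) (φ : Fin n → Fin m → NNReal), TieBreakingRule φ,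
      2 ≤ mixedPoA σ ∧ mixedPoA σ ≤ 4) := by
  refine ⟨fun I σ s hs ν hν hfeas => ?_, fun σ => ⟨two_le_mixedPoA σ, mixedPoA_le σ⟩⟩
  exact hs.liquidWelfare_le ν hfeas
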